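/- Let $t\in\mathbb{R}$ be fixed and let $w(x;t)=e^{-x^6+tx^2}$, $x\in\mathbb{R}$. Let $P_n(x;t)$, $n=0,1,2,\dots$, be the monic polynomials with $\deg P_n=n$ that are orthogonal with respect to $w$, i.e. $\int_{-\infty}^{\infty}P_j(x;t)P_k(x;t)w(x;t)\,dx=0$ for $j\neq k$, and let $\beta_n=\beta_n(t)$ be the coefficients of their three-term recurrence relation $xP_n(x;t)=P_{n+1}(x;t)+\beta_n(t)P_{n-1}(x;t)$ (with $P_0=1$, $\beta_0P_{-1}=0$, $\beta_0=0$). Then, as $n\to\infty$, $$ \begin{aligned} \beta_n(t)={}&\frac{n^{1/3}}{\sqrt[3]{60}}+\frac{t}{3\sqrt[3]{450}\,n^{1/3}}-\frac{4t^3-135}{2430\sqrt[3]{60}\,n^{5/3}}+\frac{t(2t^3-45)}{3645\sqrt[3]{450}\,n^{7/3}}-\frac{2t^2}{1215\,n^3}\\ &-\frac{16t^6-3780t^3+40095}{1476225\sqrt[3]{60}\,n^{11/3}}+\frac{t(16t^6-180t^3-112995)}{3542940\sqrt[3]{450}\,n^{13/3}}+O(n^{-5}), \end{aligned} $$ where the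 implied constant may depend on $t$. -/

import Mathlib

open Polynomial
open scoped Asymptotics

noncomputable section

namespace Freud

/-- The sextic Freud weight `w(x;t) = exp(-x^6 + t x^2)` on the real line. -/
def weight (t x : ℝ) : ℝ := Real.exp (-x ^ 6 + t * x ^ 2)

/-- The pairing `∫ p(x) q(x) w(x;t) dx` over the real line. -/
def pairing (t : ℝ) (p q : ℝ[X]) : ℝ := ∫ x : ℝ, p.eval x * q.eval x * weight t x

/-- `P 0, P 1, …` is the sequence of monic orthogonal polynomials for the weight `w(x;t)`,
`P n` having degree `n`. -/
structure IsMonicOPS (t : ℝ) (P : ℕ → ℝ[X]) : Prop where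
  monic : ∀ n, (P n).Monic
  natDegree_eq : ∀ n, (P n).natDegree = n
  orthogonal : ∀ j k, j ≠ k → pairing t (P j) (P k) = 0

/-- `β` is the sequence of coefficients in `x P_n = P_{n+1} + β_n P_{n-1}`, where the term
`β_0 P_{-1}` is zero and `β_0 = 0`. -/
structure IsRecurrenceCoeff (P : ℕ → ℝ[X]) (β : ℕ → ℝ) : Prop where
  coeff_zero : β 0 = 0
  rec_zero : X * P 0 = P 1
  rec_succ : ∀ n, X * P (n + 1) = P (n + 2) + C (β (n + 1)) * P n

theorem integrable_eval_mul_weight (t : ℝ) (p : ℝ[X]) :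
    MeasureTheory.Integrable (fun x : ℝ => p.eval x * weight t x) := by
  induction p using Polynomial.induction_on' with
  | add p q hp hq =>
    simp only [eval_add, add_mul]
    exact hp.add hq
  | monomial k a =>
    have h1 : MeasureTheory.Integrable (fun x : ℝ => x ^ k * Real.exp (-1 * x ^ 2)) := by
      have := integrable_rpow_mul_exp_neg_mul_sq (b := 1) one_pos (s := (k : ℝ))
        (by have : (0 : ℝ) ≤ k := Nat.cast_nonneg k
            linarith)
      simpa [Real.rpow_natCast] using this
    have h2 := (h1.const_mul a).norm.const_mul (Real.exp ((|t| + 1) ^ 2))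
    refine h2.mono' ?_ ?_
    · unfold weight
      exact Continuous.aestronglyMeasurable (by fun_prop)
    · refine Filter.Eventually.of_forall fun x => ?_
      have hexp : weight t x ≤ Real.exp ((|t| + 1) ^ 2) * Real.exp (-1 * x ^ 2) := by
        rw [← Real.exp_add, weight, Real.exp_le_exp]
        have ht := le_abs_self t
        have h0 := abs_nonneg t
        have hy : 0 ≤ x ^ 2 := sq_nonneg x
        have e6 : x ^ 6 = (x ^ 2) ^ 3 := by ring
        rw [e6]
        generalize x ^ 2 = y at hy
        generalize |t| = s at ht h0
        rcases le_total y (s + 1) with h | h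
        · nlinarith [pow_nonneg hy 3, mul_le_mul_of_nonneg_right ht hy]
        · have h3 : (s + 1) * y ≤ y ^ 3 := by
            have : s + 1 ≤ y ^ 2 := by nlinarith
            nlinarith
          nlinarith [mul_le_mul_of_nonneg_right ht hy, sq_nonneg (s + 1)]
      have hw : 0 ≤ weight t x := (Real.exp_pos _).le
      rw [eval_monomial, norm_mul, norm_mul, norm_mul, norm_mul, Real.norm_of_nonneg hw,
        Real.norm_of_nonneg (Real.exp_pos _).le]
      calc _ ≤ ‖a‖ * ‖x ^ k‖ * (Real.exp ((|t| + 1) ^ 2) * Real.exp (-1 * x ^ 2)) := by gcongr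
        _ = _ := by ring

theorem integrable_pairing (t : ℝ) (p q : ℝ[X]) :
    MeasureTheory.Integrable (fun x : ℝ => p.eval x * q.eval x * weight t x) := by
  simpa using integrable_eval_mul_weight t (p * q)

theorem pairing_comm (t : ℝ) (p q : ℝ[X]) : pairing t p q = pairing t q p := by
  simp only [pairing, mul_comm]

theorem pairing_add_left (t : ℝ) (p q r : ℝ[X]) :
    pairing t (p + q) r = pairing t p r + pairing t q r := by
  rw [pairing, pairing, pairing,
    ← MeasureTheory.integral_add (integrable_pairing t p r) (integrable_pairing t q r)]
  simp only [eval_add, add_mul]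

theorem pairing_C_mul_left (t a : ℝ) (p r : ℝ[X]) :
    pairing t (C a * p) r = a * pairing t p r := by
  rw [pairing, pairing, ← MeasureTheory.integral_const_mul]
  simp only [eval_mul, eval_C, mul_assoc]

theorem pairing_add_right (t : ℝ) (p q r : ℝ[X]) :
    pairing t r (p + q) = pairing t r p + pairing t r q := by
  rw [pairing_comm, pairing_add_left, pairing_comm t p, pairing_comm t q]

theorem pairing_C_mul_right (t a : ℝ) (p r : ℝ[X]) :
    pairing t r (C a * p) = a * pairing t r p := by
  rw [pairing_comm, pairing_C_mul_left, pairing_comm]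

theorem pairing_X_mul (t : ℝ) (p q : ℝ[X]) : pairing t (X * p) q = pairing t p (X * q) := by
  simp only [pairing, eval_mul, eval_X]
  congr 1
  ext x
  ring

theorem pairing_self_pos (t : ℝ) {p : ℝ[X]} (hp : p ≠ 0) : 0 < pairing t p p := by
  obtain ⟨x, hx⟩ : ∃ x, p.eval x ≠ 0 := by
    by_contra! h
    exact hp (Polynomial.funext (by simpa using h))
  refine MeasureTheory.integral_pos_of_integrable_nonneg_nonzero (x := x) ?_
    (integrable_pairing t p p) ?_ ?_
  · unfold weight
    fun_prop
  · intro y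
    exact mul_nonneg (mul_self_nonneg _) (Real.exp_pos _).le
  · exact mul_ne_zero (mul_ne_zero hx hx) (Real.exp_pos _).ne'

/-- Auxiliary construction: the polynomials produced by the three-term recurrence with
`β_n = h_n / h_{n-1}`. -/
def aux (t : ℝ) : ℕ → ℝ[X]
  | 0 => 1
  | 1 => X
  | n + 2 => X * aux t (n + 1) -
      C (pairing t (aux t (n + 1)) (aux t (n + 1)) / pairing t (aux t n) (aux t n)) * aux t n

theorem aux_monic_natDegree (t : ℝ) :
    ∀ n, (aux t n).Monic ∧ (aux t n).natDegree = n := by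
  intro n
  induction n using Nat.twoStepInduction with
  | zero => simp [aux]
  | one => simp [aux, monic_X]
  | more n h0 h1 =>
    rw [aux]
    have hX : (X * aux t (n + 1)).Monic := monic_X.mul h1.1
    have hXd : (X * aux t (n + 1)).natDegree = n + 2 := by
      rw [monic_X.natDegree_mul h1.1, h1.2, natDegree_X]
      ring
    generalize pairing t (aux t (n + 1)) (aux t (n + 1)) / pairing t (aux t n) (aux t n) = b
    have hlt : (C b * aux t n).degree < (X * aux t (n + 1)).degree := by
      rw [degree_eq_natDegree hX.ne_zero, hXd]
      have hle : (C b * aux t n).degree ≤ (n : WithBot ℕ) :=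
        degree_le_of_natDegree_le ((natDegree_C_mul_le _ _).trans h0.2.le)
      refine lt_of_le_of_lt hle ?_
      exact_mod_cast (by omega : n < n + 2)
    refine ⟨hX.sub_of_left hlt, ?_⟩
    rw [natDegree_eq_of_degree_eq (degree_sub_eq_left_of_degree_lt hlt), hXd]

theorem aux_eval_neg (t x : ℝ) :
    ∀ n, (aux t n).eval (-x) = (-1) ^ n * (aux t n).eval x := by
  intro n
  induction n using Nat.twoStepInduction with
  | zero => simp [aux]
  | one => simp [aux]
  | more n h0 h1 =>
    rw [aux]
    simp only [eval_sub, eval_mul, eval_X, eval_C, h0, h1]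
    ring

theorem aux_pairing_X_self (t : ℝ) (n : ℕ) : pairing t (X * aux t n) (aux t n) = 0 := by
  have h := MeasureTheory.integral_neg_eq_self
    (fun x : ℝ => (X * aux t n).eval x * (aux t n).eval x * weight t x) MeasureTheory.volume
  have h2 : ∀ x : ℝ, (X * aux t n).eval (-x) * (aux t n).eval (-x) * weight t (-x) =
      -((X * aux t n).eval x * (aux t n).eval x * weight t x) := by
    intro x
    have hs : ((-1 : ℝ) ^ n) * (-1) ^ n = 1 := by rw [← mul_pow]; norm_num
    have hw : weight t (-x) = weight t x := by
      unfold weight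
      congr 1
      ring
    simp only [eval_mul, eval_X, aux_eval_neg, hw]
    linear_combination (-(x * (aux t n).eval x * (aux t n).eval x * weight t x)) * hs
  simp only [h2, MeasureTheory.integral_neg] at h
  unfold pairing
  linarith

theorem aux_rec (t : ℝ) (n : ℕ) : X * aux t (n + 1) = aux t (n + 2) +
    C (pairing t (aux t (n + 1)) (aux t (n + 1)) / pairing t (aux t n) (aux t n)) * aux t n := by
  rw [aux]
  ring

theorem aux_orth (t : ℝ) : ∀ n k, k < n → pairing t (aux t n) (aux t k) = 0 := by
  intro n
  induction n using Nat.twoStepInduction with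
  | zero => intro k hk; omega
  | one =>
    intro k hk
    obtain rfl : k = 0 := by omega
    simpa [aux] using aux_pairing_X_self t 0
  | more n h0 h1 =>
    intro k hk
    have e : pairing t (aux t (n + 2)) (aux t k) = pairing t (X * aux t (n + 1)) (aux t k) -
        pairing t (aux t (n + 1)) (aux t (n + 1)) / pairing t (aux t n) (aux t n) *
          pairing t (aux t n) (aux t k) := by
      rw [aux_rec, pairing_add_left, pairing_C_mul_left]
      ring
    rw [e]
    rcases (by omega : k = n + 1 ∨ k = n ∨ k < n) with rfl | rfl | hkn
    · rw [aux_pairing_X_self, pairing_comm t (aux t n) (aux t (n + 1)), h1 n (by omega)]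
      ring
    · have hpos := (pairing_self_pos t (aux_monic_natDegree t k).1.ne_zero).ne'
      rw [pairing_X_mul, div_mul_cancel₀ _ hpos]
      cases k with
      | zero => simp [aux]
      | succ m =>
        rw [aux_rec t m, pairing_add_right, pairing_C_mul_right, h1 m (by omega)]
        ring
    · rw [pairing_X_mul, h0 k hkn]
      cases k with
      | zero =>
        have : X * aux t 0 = aux t 1 := by simp [aux]
        rw [this, h1 1 (by omega)]
        ring
      | succ m =>
        rw [aux_rec t m, pairing_add_right, pairing_C_mul_right, h1 m (by omega),
          h1 (m + 2) (by omega)]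
        ring

theorem aux_isMonicOPS (t : ℝ) : IsMonicOPS t (aux t) where
  monic n := (aux_monic_natDegree t n).1
  natDegree_eq n := (aux_monic_natDegree t n).2
  orthogonal j k hjk := by
    rcases lt_or_gt_of_ne hjk with h | h
    · rw [pairing_comm]
      exact aux_orth t k j h
    · exact aux_orth t j k h

theorem IsMonicOPS.pairing_eq_zero {t : ℝ} {P : ℕ → ℝ[X]} (hP : IsMonicOPS t P) (n : ℕ) :
    ∀ m ≤ n, ∀ q : ℝ[X], q.degree < m → pairing t (P n) q = 0 := by
  intro m
  induction m with
  | zero =>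
    intro _ q hq
    have : q = 0 := by simpa [Nat.WithBot.lt_zero_iff] using hq
    simp [this, pairing]
  | succ m ih =>
    intro hm q hq
    have e : q = (q - C (q.coeff m) * P m) + C (q.coeff m) * P m := by ring
    have hdeg : (q - C (q.coeff m) * P m).degree < m := by
      rw [degree_lt_iff_coeff_zero] at hq ⊢
      intro i hi
      rcases Nat.eq_or_lt_of_le hi with rfl | hlt
      · have : (P m).coeff m = 1 := by
          have := hP.monic m
          rwa [Monic, leadingCoeff, hP.natDegree_eq] at this
        simp [this]
      · have : (P m).coeff i = 0 :=
          coeff_eq_zero_of_natDegree_lt (by rw [hP.natDegree_eq]; exact hlt)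
        simp [this, hq i (by omega)]
    rw [e, pairing_add_right, pairing_C_mul_right, ih (by omega) _ hdeg,
      hP.orthogonal n m (by omega)]
    ring

theorem IsMonicOPS.unique {t : ℝ} {P Q : ℕ → ℝ[X]} (hP : IsMonicOPS t P)
    (hQ : IsMonicOPS t Q) : P = Q := by
  funext n
  by_contra hne
  have hd : (P n - Q n).degree < n := by
    have hPd : (P n).degree = n := by
      rw [degree_eq_natDegree (hP.monic n).ne_zero, hP.natDegree_eq]
    have hQd : (Q n).degree = n := by
      rw [degree_eq_natDegree (hQ.monic n).ne_zero, hQ.natDegree_eq]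
    rw [← hPd]
    exact degree_sub_lt_left (hPd.trans hQd.symm) (hP.monic n).ne_zero
      ((hP.monic n).trans (hQ.monic n).symm)
  have h1 := hP.pairing_eq_zero n n le_rfl _ hd
  have h2 := hQ.pairing_eq_zero n n le_rfl _ hd
  have e : P n = (P n - Q n) + Q n := by ring
  have h3 : pairing t (P n) (P n - Q n) =
      pairing t (P n - Q n) (P n - Q n) + pairing t (Q n) (P n - Q n) := by
    rw [← pairing_add_left, ← e]
  have h4 := pairing_self_pos t (sub_ne_zero.mpr hne)
  linarith

theorem existsUnique_isMonicOPS (t : ℝ) : ∃! P : ℕ → ℝ[X], IsMonicOPS t P :=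
  ⟨aux t, aux_isMonicOPS t, fun _ hQ => hQ.unique (aux_isMonicOPS t)⟩

/-- The monic orthogonal polynomials `P_n(x;t)` for the weight `w(x;t)`. -/
def monicOP (t : ℝ) : ℕ → ℝ[X] := (existsUnique_isMonicOPS t).choose

theorem monicOP_isMonicOPS (t : ℝ) : IsMonicOPS t (monicOP t) :=
  (existsUnique_isMonicOPS t).choose_spec.1

theorem existsUnique_isRecurrenceCoeff (t : ℝ) :
    ∃! β : ℕ → ℝ, IsRecurrenceCoeff (monicOP t) β := by
  have hP := monicOP_isMonicOPS t
  have e : monicOP t = aux t := hP.unique (aux_isMonicOPS t)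
  refine ⟨fun n => Nat.casesOn n 0 fun m => pairing t (aux t (m + 1)) (aux t (m + 1)) /
    pairing t (aux t m) (aux t m), ⟨rfl, by rw [e]; simp [aux], fun n => by
      rw [e]; exact aux_rec t n⟩, ?_⟩
  intro β hβ
  funext n
  cases n with
  | zero => exact hβ.coeff_zero
  | succ n =>
    have h1 := hβ.rec_succ n
    rw [e, aux_rec] at h1
    have h2 := mul_right_cancel₀ (aux_monic_natDegree t n).1.ne_zero (add_left_cancel h1)
    exact (C_injective h2).symm

/-- The recurrence coefficients `β_n(t)` of the monic orthogonal polynomials `P_n(x;t)`. -/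
def recurrenceCoeff (t : ℝ) : ℕ → ℝ := (existsUnique_isRecurrenceCoeff t).choose

theorem recurrenceCoeff_isRecurrenceCoeff (t : ℝ) :
    IsRecurrenceCoeff (monicOP t) (recurrenceCoeff t) :=
  (existsUnique_isRecurrenceCoeff t).choose_spec.1

end Freud

end

/-! Integrating the derivative of `P (n + 1) * P n * w` gives the string equation, a cubic relation
between five consecutive recurrence coefficients. Its cubic part `stringForm` is monotone on
nonnegative windows, so `β n` divided by `(n / 60) ^ (1 / 3)` stays bounded. If `a ≤ A` are the
extreme cluster points of this quotient, then the window centred at `A` has entries at least `a` and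
the window centred at `a` has entries at most `A`, and the two resulting inequalities force
`a = A = 1`.

For the expansion put `w = (n / 60) ^ (-1 / 3)`. The truncated formal solution, rescaled by `w`,
satisfies the string equation up to `O(w ^ 16)`. The linearization of `stringForm` at the constant
window has the coefficients `1, 6, 16, 6, 1`; since `1 + 6 + 6 + 1 < 16`, the error at the centre of
a window is at most a factor smaller than `1` times the largest error in the window, plus
`O(w ^ 15)`. As the error has polynomial growth, iterating this contraction leaves `O(w ^ 15)`,
which is `O(n ^ (-5))`. -/

noncomputable section

namespace Freud

open Filter Topology

theorem hasDerivAt_weight (t x : ℝ) :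
    HasDerivAt (weight t) (weight t x * (-(6 * x ^ 5) + t * (2 * x))) x := by
  have hexponent : HasDerivAt (fun x : ℝ => -x ^ 6 + t * x ^ 2) (-(6 * x ^ 5) + t * (2 * x)) x := by
    simpa using (hasDerivAt_pow 6 x).fun_neg.fun_add ((hasDerivAt_pow 2 x).const_mul t)
  exact hexponent.exp

theorem pairing_derivative (t : ℝ) (p q : ℝ[X]) :
    pairing t (derivative p) q + pairing t p (derivative q) =
      6 * pairing t (X ^ 5 * p) q - 2 * t * pairing t (X * p) q := by
  have hderiv (x : ℝ) : HasDerivAt (fun x => p.eval x * q.eval x * weight t x)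
      (((derivative p).eval x * q.eval x * weight t x +
        p.eval x * (derivative q).eval x * weight t x) -
        (6 * ((X ^ 5 * p).eval x * q.eval x * weight t x) -
          2 * t * ((X * p).eval x * q.eval x * weight t x))) x := by
    refine (((p.hasDerivAt x).fun_mul (q.hasDerivAt x)).fun_mul
      (hasDerivAt_weight t x)).congr_deriv ?_
    simp only [eval_mul, eval_pow, eval_X]
    ring
  have hleft := (integrable_pairing t (derivative p) q).fun_add
    (integrable_pairing t p (derivative q))
  have hquintic := (integrable_pairing t (X ^ 5 * p) q).const_mul 6
  have hlinear := (integrable_pairing t (X * p) q).const_mul (2 * t)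
  have hright := hquintic.sub hlinear
  have h := (MeasureTheory.integral_sub hleft hright).symm.trans
    (MeasureTheory.integral_eq_zero_of_hasDerivAt_of_integrable hderiv (hleft.sub hright)
      (integrable_pairing t p q))
  rw [MeasureTheory.integral_add (integrable_pairing t _ q) (integrable_pairing t p _),
    MeasureTheory.integral_sub' hquintic hlinear, MeasureTheory.integral_const_mul,
    MeasureTheory.integral_const_mul] at h
  exact sub_eq_zero.1 h

/-- The sextic part of the string equation on a window `x = (β (n - 2), …, β (n + 2))`: the
coefficient of `P (n - 1)` in `X ^ 5 * P n`. -/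
def stringForm (x : Fin 5 → ℝ) : ℝ :=
  x 2 * (x 0 * x 1 + x 1 ^ 2 + 2 * x 1 * x 2 + x 1 * x 3 + x 2 ^ 2 + 2 * x 2 * x 3 + x 3 ^ 2
    + x 3 * x 4)

section Recurrence

variable {t : ℝ} {P : ℕ → ℝ[X]} {β : ℕ → ℝ}

theorem IsMonicOPS.coeff_self (hP : IsMonicOPS t P) (n : ℕ) : (P n).coeff n = 1 := by
  simpa only [Monic, leadingCoeff, hP.natDegree_eq] using hP.monic n

theorem IsMonicOPS.coeff_eq_zero (hP : IsMonicOPS t P) {m n : ℕ} (h : n < m) :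
    (P n).coeff m = 0 :=
  coeff_eq_zero_of_natDegree_lt (by rwa [hP.natDegree_eq])

theorem IsMonicOPS.pairing_derivative_succ (hP : IsMonicOPS t P) (n : ℕ) :
    pairing t (derivative (P (n + 1))) (P n) = (n + 1) * pairing t (P n) (P n) := by
  have hdeg : (derivative (P (n + 1)) - C ((n : ℝ) + 1) * P n).degree < n := by
    rw [degree_lt_iff_coeff_zero]
    intro i hi
    rw [coeff_sub, coeff_C_mul, coeff_derivative]
    rcases Nat.eq_or_lt_of_le hi with rfl | hlt
    · rw [hP.coeff_self, hP.coeff_self]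
      ring
    · rw [hP.coeff_eq_zero (by omega), hP.coeff_eq_zero hlt]
      ring
  have hsplit : derivative (P (n + 1)) =
      (derivative (P (n + 1)) - C ((n : ℝ) + 1) * P n) + C ((n : ℝ) + 1) * P n := by ring
  rw [hsplit, pairing_add_left, pairing_C_mul_left, pairing_comm,
    hP.pairing_eq_zero n n le_rfl _ hdeg, zero_add]

theorem IsMonicOPS.pairing_succ_derivative (hP : IsMonicOPS t P) (n : ℕ) :
    pairing t (P (n + 1)) (derivative (P n)) = 0 := by
  refine hP.pairing_eq_zero (n + 1) (n + 1) le_rfl _ (degree_derivative_le.trans_lt ?_)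
  rw [degree_eq_natDegree (hP.monic n).ne_zero, hP.natDegree_eq]
  exact_mod_cast Nat.lt_succ_self n

theorem IsRecurrenceCoeff.pairing_X_mul_succ (hP : IsMonicOPS t P) (hβ : IsRecurrenceCoeff P β)
    (n : ℕ) : pairing t (X * P (n + 1)) (P n) = β (n + 1) * pairing t (P n) (P n) := by
  rw [hβ.rec_succ, pairing_add_left, pairing_C_mul_left, hP.orthogonal _ _ (by omega), zero_add]

theorem IsRecurrenceCoeff.pairing_self_succ (hP : IsMonicOPS t P) (hβ : IsRecurrenceCoeff P β)
    (n : ℕ) : pairing t (P (n + 1)) (P (n + 1)) = β (n + 1) * pairing t (P n) (P n) := by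
  rw [← hβ.pairing_X_mul_succ hP, pairing_X_mul]
  cases n with
  | zero => rw [hβ.rec_zero]
  | succ m =>
    rw [hβ.rec_succ, pairing_add_right, pairing_C_mul_right, hP.orthogonal (m + 2) m (by omega),
      mul_zero, add_zero]

theorem IsRecurrenceCoeff.succ_pos (hP : IsMonicOPS t P) (hβ : IsRecurrenceCoeff P β) (n : ℕ) :
    0 < β (n + 1) := by
  have hsucc := pairing_self_pos t (hP.monic (n + 1)).ne_zero
  rw [hβ.pairing_self_succ hP] at hsucc
  exact pos_of_mul_pos_left hsucc (pairing_self_pos t (hP.monic n).ne_zero).le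

theorem IsRecurrenceCoeff.X_pow_two_mul (hβ : IsRecurrenceCoeff P β) (n : ℕ) :
    X ^ 2 * P (n + 2) = P (n + 4) + (C (β (n + 3) + β (n + 2)) * P (n + 2) +
      C (β (n + 2) * β (n + 1)) * P n) := by
  simp only [map_add, map_mul]
  linear_combination X * hβ.rec_succ (n + 1) + hβ.rec_succ (n + 2) + C (β (n + 2)) * hβ.rec_succ n

theorem IsRecurrenceCoeff.X_pow_three_mul (hβ : IsRecurrenceCoeff P β) (n : ℕ) :
    X ^ 3 * P (n + 3) = P (n + 6) + (C (β (n + 5) + β (n + 4) + β (n + 3)) * P (n + 4) +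
      (C (β (n + 3) * (β (n + 4) + β (n + 3) + β (n + 2))) * P (n + 2) +
        C (β (n + 3) * β (n + 2) * β (n + 1)) * P n)) := by
  have hsq := hβ.X_pow_two_mul (n + 1)
  simp only [map_add, map_mul] at hsq ⊢
  linear_combination X * hsq + hβ.rec_succ (n + 4) +
    (C (β (n + 4)) + C (β (n + 3))) * hβ.rec_succ (n + 2) +
    C (β (n + 3)) * C (β (n + 2)) * hβ.rec_succ n

theorem IsRecurrenceCoeff.pairing_X_pow_five_mul (hP : IsMonicOPS t P)
    (hβ : IsRecurrenceCoeff P β) (n : ℕ) : pairing t (X ^ 5 * P (n + 3)) (P (n + 2)) =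
      stringForm (fun i => β (n + 1 + i)) * pairing t (P (n + 2)) (P (n + 2)) := by
  have hsplit : pairing t (X ^ 5 * P (n + 3)) (P (n + 2)) =
      pairing t (X ^ 3 * P (n + 3)) (X ^ 2 * P (n + 2)) := by
    rw [pow_two, mul_assoc X X, ← pairing_X_mul, ← pairing_X_mul]
    ring_nf
  rw [hsplit, hβ.X_pow_three_mul, hβ.X_pow_two_mul]
  simp only [pairing_add_left, pairing_add_right, pairing_C_mul_left, pairing_C_mul_right]
  simp (disch := omega) only [hP.orthogonal]
  rw [hβ.pairing_self_succ hP (n + 3), hβ.pairing_self_succ hP (n + 2),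
    hβ.pairing_self_succ hP (n + 1), hβ.pairing_self_succ hP n]
  simp only [stringForm, Fin.coe_ofNat_eq_mod, Nat.reduceMod]
  ring

theorem IsRecurrenceCoeff.string_equation (hP : IsMonicOPS t P) (hβ : IsRecurrenceCoeff P β)
    (n : ℕ) : 6 * stringForm (fun i => β (n + 1 + i)) - 2 * t * β (n + 3) = (n + 3 : ℕ) := by
  have h := pairing_derivative t (P (n + 3)) (P (n + 2))
  rw [hP.pairing_derivative_succ, hP.pairing_succ_derivative, hβ.pairing_X_pow_five_mul hP,
    hβ.pairing_X_mul_succ hP] at h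
  refine mul_right_cancel₀ (pairing_self_pos t (hP.monic (n + 2)).ne_zero).ne' ?_
  push_cast at h ⊢
  linear_combination -h

end Recurrence

/-- A sequence that is eventually nonnegative and eventually solves the string equation of the
sextic Freud weight, written for the window centred at `n + 2`. -/
structure IsStringSolution (t : ℝ) (β : ℕ → ℝ) : Prop where
  nonneg : ∀ᶠ n in atTop, 0 ≤ β n
  string_eq : ∀ᶠ n in atTop,
    6 * stringForm (fun i => β (n + i)) - 2 * t * β (n + 2) = (n + 2 : ℕ)

theorem IsRecurrenceCoeff.isStringSolution {t : ℝ} {P : ℕ → ℝ[X]} {β : ℕ → ℝ}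
    (hP : IsMonicOPS t P) (hβ : IsRecurrenceCoeff P β) : IsStringSolution t β where
  nonneg := by
    filter_upwards [eventually_ge_atTop 1] with n hn
    obtain ⟨k, rfl⟩ := Nat.exists_eq_add_of_le' hn
    exact (hβ.succ_pos hP k).le
  string_eq := by
    filter_upwards [eventually_ge_atTop 1] with n hn
    obtain ⟨k, rfl⟩ := Nat.exists_eq_add_of_le' hn
    exact hβ.string_equation hP k

/-! ### The leading term -/

theorem stringForm_smul (c : ℝ) (x : Fin 5 → ℝ) : stringForm (c • x) = c ^ 3 * stringForm x := by
  simp only [stringForm, Pi.smul_apply, smul_eq_mul]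
  ring

theorem pow_three_le_stringForm {x : Fin 5 → ℝ} (hx : 0 ≤ x) : x 2 ^ 3 ≤ stringForm x := by
  have h0 : 0 ≤ x 0 := hx 0
  have h1 : 0 ≤ x 1 := hx 1
  have h2 : 0 ≤ x 2 := hx 2
  have h3 : 0 ≤ x 3 := hx 3
  have h4 : 0 ≤ x 4 := hx 4
  have hrest : 0 ≤ x 2 * (x 0 * x 1 + x 1 ^ 2 + 2 * x 1 * x 2 + x 1 * x 3 + 2 * x 2 * x 3
    + x 3 ^ 2 + x 3 * x 4) := by positivity
  simp only [stringForm]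
  linarith

theorem stringForm_mono {x y : Fin 5 → ℝ} (hx : 0 ≤ x) (hxy : x ≤ y) :
    stringForm x ≤ stringForm y := by
  have h0 : 0 ≤ x 0 := hx 0
  have h1 : 0 ≤ x 1 := hx 1
  have h2 : 0 ≤ x 2 := hx 2
  have h3 : 0 ≤ x 3 := hx 3
  have h4 : 0 ≤ x 4 := hx 4
  have hy (i : Fin 5) : 0 ≤ y i := (hx i).trans (hxy i)
  simp only [stringForm]
  gcongr <;> first | exact hxy _ | linarith [hy 0, hy 1, hy 2, hy 3]

theorem continuous_stringForm : Continuous stringForm := by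
  unfold stringForm
  fun_prop

/-- The reciprocal of the leading term `(n / 60) ^ (1 / 3)` of `β n`. -/
def scale (n : ℕ) : ℝ := ((n : ℝ) / 60) ^ (-(1 / 3) : ℝ)

theorem scale_pos {n : ℕ} (hn : 0 < n) : 0 < scale n := by
  unfold scale
  positivity

theorem scale_pow_three (n : ℕ) : scale n ^ 3 = 60 / n := by
  rw [scale, ← Real.rpow_mul_natCast (by positivity)]
  norm_num [Real.rpow_neg_one]

theorem tendsto_scale : Tendsto scale atTop (𝓝 0) :=
  (tendsto_rpow_neg_atTop (by norm_num)).comp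
    (tendsto_natCast_atTop_atTop.atTop_div_const (by norm_num))

theorem tendsto_natCast_add_div_natCast_add (i j : ℕ) :
    Tendsto (fun n : ℕ => ((n + i : ℕ) : ℝ) / (n + j : ℕ)) atTop (𝓝 1) := by
  have h := (tendsto_natCast_div_add_atTop ((j : ℝ) - i)).comp (tendsto_add_atTop_nat i)
  refine h.congr fun n => ?_
  simp

theorem tendsto_scale_add_div_scale_add (i j : ℕ) :
    Tendsto (fun n => scale (n + i) / scale (n + j)) atTop (𝓝 1) := by
  have h := (tendsto_natCast_add_div_natCast_add i j).rpow_const (p := -(1 / 3))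
    (Or.inl one_ne_zero)
  rw [Real.one_rpow] at h
  refine h.congr fun n => ?_
  rw [scale, scale, ← Real.div_rpow (by positivity) (by positivity),
    div_div_div_cancel_right₀ (by norm_num)]

/-- The window `β n, …, β (n + 4)` divided by the leading term at its centre. -/
def scaledWindow (β : ℕ → ℝ) (n : ℕ) : Fin 5 → ℝ := scale (n + 2) • fun i : Fin 5 => β (n + i)

theorem scaledWindow_apply (β : ℕ → ℝ) {n : ℕ} {i : Fin 5} (h : 0 < n + i) :
    scaledWindow β n i = scale (n + 2) / scale (n + i) * (scale (n + i) * β (n + i)) := by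
  have := (scale_pos h).ne'
  simp only [scaledWindow, Pi.smul_apply, smul_eq_mul]
  field_simp

theorem IsStringSolution.stringForm_scaledWindow {t : ℝ} {β : ℕ → ℝ} (hβ : IsStringSolution t β) :
    ∀ᶠ n in atTop, stringForm (scaledWindow β n) =
      10 + t / 3 * scale (n + 2) ^ 2 * scaledWindow β n 2 := by
  filter_upwards [hβ.string_eq] with n hn
  have hpow : scale (n + 2) ^ 3 * (n + 2 : ℕ) = 60 := by
    rw [scale_pow_three]
    field_simp
  simp only [scaledWindow, stringForm_smul, Pi.smul_apply, smul_eq_mul, Fin.val_two]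
  linear_combination scale (n + 2) ^ 3 / 6 * hn + hpow / 6

theorem IsStringSolution.scaledWindow_nonneg {t : ℝ} {β : ℕ → ℝ} (hβ : IsStringSolution t β) :
    ∀ᶠ n in atTop, 0 ≤ scaledWindow β n := by
  simp only [Pi.le_def, eventually_all]
  intro i
  filter_upwards [(tendsto_add_atTop_nat i).eventually hβ.nonneg] with n hn
  exact mul_nonneg (scale_pos (by omega)).le hn

theorem tendsto_mul_scale_sq (c : ℝ) : Tendsto (fun n => c * scale n ^ 2) atTop (𝓝 0) := by
  simpa using (tendsto_scale.pow 2).const_mul c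

theorem IsStringSolution.scale_mul_mem_Icc {t : ℝ} {β : ℕ → ℝ} (hβ : IsStringSolution t β) :
    ∀ᶠ n in atTop, scale n * β n ∈ Set.Icc 0 3 := by
  have hsmall := (tendsto_add_atTop_nat 2).eventually
    ((tendsto_mul_scale_sq (t / 3)).eventually_le_const one_pos)
  rw [← map_add_atTop_eq_nat 2, eventually_map]
  filter_upwards [hβ.stringForm_scaledWindow, hβ.scaledWindow_nonneg, hsmall] with n heq hpos hlin
  change 0 ≤ scaledWindow β n 2 ∧ scaledWindow β n 2 ≤ 3
  have hcube := pow_three_le_stringForm hpos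
  have hx := hpos 2
  refine ⟨hx, ?_⟩
  nlinarith [mul_le_mul_of_nonneg_right hlin hx, sq_nonneg (scaledWindow β n 2)]

theorem IsStringSolution.exists_stringForm_eq_of_mapClusterPt {t : ℝ} {β : ℕ → ℝ}
    (hβ : IsStringSolution t β) {x : ℝ} (hx : MapClusterPt x atTop fun n => scale n * β n) :
    ∃ ℓ : Fin 5 → ℝ, (∀ i, MapClusterPt (ℓ i) atTop fun n => scale n * β n) ∧
      ℓ 2 = x ∧ stringForm ℓ = 10 := by
  rw [MapClusterPt, ← map_add_atTop_eq_nat 2, map_map, ← MapClusterPt,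
    mapClusterPt_iff_ultrafilter] at hx
  -- Along an ultrafilter, all entries of the window converge simultaneously.
  obtain ⟨U, hU, hUx⟩ := hx
  have hshift (i : ℕ) : Tendsto (fun n => n + i) U atTop := (tendsto_add_atTop_nat i).mono_left hU
  have hlim (i : Fin 5) : ∃ y, Tendsto (fun n => scale (n + i) * β (n + i)) U (𝓝 y) := by
    obtain ⟨y, -, hy⟩ := isCompact_Icc.ultrafilter_le_nhds
      (U.map fun n => scale (n + i) * β (n + i))
      (le_principal_iff.2 ((hshift i).eventually hβ.scale_mul_mem_Icc))
    exact ⟨y, hy⟩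
  choose ℓ hℓ using hlim
  have hwindow : Tendsto (scaledWindow β) U (𝓝 ℓ) := by
    refine tendsto_pi_nhds.2 fun i => ?_
    have h := ((tendsto_scale_add_div_scale_add 2 i).mono_left hU).mul (hℓ i)
    rw [one_mul] at h
    refine h.congr' ?_
    filter_upwards [hU (eventually_gt_atTop 0)] with n hn
    exact (scaledWindow_apply β (by positivity)).symm
  refine ⟨ℓ, fun i => ?_, tendsto_nhds_unique (hℓ 2) hUx, ?_⟩
  · exact (hℓ i).mapClusterPt.of_comp (hshift i)
  have hlin := ((tendsto_mul_scale_sq (t / 3)).comp (hshift 2)).mul (tendsto_pi_nhds.1 hwindow 2)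
  have hright := hlin.const_add 10
  rw [zero_mul, add_zero] at hright
  exact tendsto_nhds_unique ((continuous_stringForm.tendsto ℓ).comp hwindow)
    (hright.congr' (hU (hβ.stringForm_scaledWindow.mono fun n hn => hn.symm)))

theorem eq_one_of_stringForm_le {a A : ℝ} (ha : 0 ≤ a) (haA : a ≤ A)
    (hlow : stringForm (Function.update (fun _ => a) 2 A) ≤ 10)
    (hhigh : 10 ≤ stringForm (Function.update (fun _ => A) 2 a)) : a = 1 ∧ A = 1 := by
  simp only [stringForm, Function.update_self, Function.update_of_ne, ne_eq, Fin.reduceEq,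
    not_false_eq_true] at hlow hhigh
  have hsq : (A - a) * (A ^ 2 + a ^ 2) ≤ 0 := by linarith
  obtain rfl : a = A := by
    by_contra hne
    have hlt := lt_of_le_of_ne haA hne
    have hA := ha.trans_lt hlt
    exact hsq.not_gt (mul_pos (sub_pos.2 hlt) (by positivity))
  have hcube : a ^ 3 = 1 := by linarith
  have h1 := (pow_eq_one_iff_of_nonneg ha three_ne_zero).1 hcube
  exact ⟨h1, h1⟩

theorem IsStringSolution.tendsto_scale_mul {t : ℝ} {β : ℕ → ℝ} (hβ : IsStringSolution t β) :
    Tendsto (fun n => scale n * β n) atTop (𝓝 1) := by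
  set S := {x | MapClusterPt x atTop fun n => scale n * β n}
  have hmem := hβ.scale_mul_mem_Icc
  have hSI : S ⊆ Set.Icc 0 3 := fun x hx =>
    isClosed_Icc.mem_of_mapClusterPt hx hmem
  have hScomp : IsCompact S := isCompact_Icc.of_isClosed_subset isClosed_setOfPred_clusterPt hSI
  obtain ⟨y, -, hy⟩ := isCompact_Icc.exists_mapClusterPt (le_principal_iff.2 hmem)
  obtain ⟨a, haS, ha⟩ := hScomp.exists_isLeast ⟨y, hy⟩
  obtain ⟨A, hAS, hA⟩ := hScomp.exists_isGreatest ⟨y, hy⟩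
  have hlow : stringForm (Function.update (fun _ => a) 2 A) ≤ 10 := by
    obtain ⟨ℓ, hℓS, hℓA, hℓ⟩ := hβ.exists_stringForm_eq_of_mapClusterPt hAS
    rw [← hℓ]
    refine stringForm_mono (le_update_iff.2 ⟨(hSI hAS).1, fun _ _ => (hSI haS).1⟩) ?_
    exact update_le_iff.2 ⟨hℓA.ge, fun i _ => ha (hℓS i)⟩
  have hhigh : 10 ≤ stringForm (Function.update (fun _ => A) 2 a) := by
    obtain ⟨ℓ, hℓS, hℓa, hℓ⟩ := hβ.exists_stringForm_eq_of_mapClusterPt haS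
    rw [← hℓ]
    refine stringForm_mono (fun i => (hSI (hℓS i)).1) ?_
    exact le_update_iff.2 ⟨hℓa.le, fun i _ => hA (hℓS i)⟩
  obtain ⟨rfl, rfl⟩ := eq_one_of_stringForm_le (hSI haS).1 (ha hAS) hlow hhigh
  exact isCompact_Icc.tendsto_nhds_of_unique_mapClusterPt hmem fun x _ hx =>
    (hA hx).antisymm (ha hx)

/-! ### The formal solution -/

theorem ring_choose_succ {K : Type*} [Field K] [CharZero K] (a : K) (n : ℕ) :
    Ring.choose a (n + 1) = Ring.choose a n * (a - n) / (n + 1) := by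
  have hn : (n : K) + 1 ≠ 0 := n.cast_add_one_ne_zero
  rw [Ring.choose_eq_smul, Ring.choose_eq_smul, descPochhammer_succ_right, smeval_mul,
    Nat.factorial_succ]
  simp only [Nat.cast_mul, Nat.cast_add, Nat.cast_one, mul_inv_rev, smeval_sub, smeval_X, pow_one,
    smeval_natCast, pow_zero, nsmul_eq_mul, mul_one, smul_eq_mul]
  field_simp

/-- The coefficients of the formal solution `β_n ~ ∑ k, seriesCoeff t k / 90 ^ k * (n / 60) ^ a_k`,
`a_k = (1 - 2 * k) / 3`, of the string equation, as far as `k = 7` (and zero afterwards). They are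
found by comparing the coefficients of `X ^ k` in `X_pow_eight_dvd_stringPoly`. -/
def seriesCoeff (t : ℝ) : ℕ → ℝ
  | 0 => 1
  | 1 => t
  | 3 => 45 / 4 - t ^ 3 / 3
  | 4 => t ^ 4 / 3 - 15 / 2 * t
  | 5 => -45 * t ^ 2
  | 6 => -4 / 9 * t ^ 6 + 105 * t ^ 3 - 4455 / 4
  | 7 => 5 / 9 * t ^ 7 - 25 / 4 * t ^ 4 - 62775 / 16 * t
  | _ => 0

/-- The coefficient of `s ^ k * u ^ i` in `∑ k, seriesCoeff t k * s ^ k * (1 + u) ^ a_k`. -/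
def binomialCoeff (t : ℝ) (k i : ℕ) : ℝ :=
  seriesCoeff t k * Ring.choose ((1 - 2 * k) / 3 : ℝ) i

/-- The even (`r = 0`) and the odd (`r = 1`) part in `v` of the Taylor polynomial of
`∑ k, seriesCoeff t k * s ^ k * (1 + j * v) ^ a_k`, after the substitution
`v ^ 2 = 405 / 2 * s ^ 3`; the odd part is stripped of one factor `v`. The variables stand for
`s = w ^ 2 / 90` and `v = w ^ 3 / 60`, as in `profileTaylor`. -/
def shiftPoly (t j : ℝ) (r : ℕ) : ℝ[X] :=
  ∑ i ∈ Finset.range 3,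
    (∑ k ∈ Finset.range 8, C (binomialCoeff t k (2 * i + r) * j ^ (2 * i + r) * (405 / 2) ^ i)
      * X ^ k) * X ^ (3 * i)

theorem coeff_shiftPoly (t j : ℝ) (r : ℕ) {d : ℕ} (hd : d < 8) :
    (shiftPoly t j r).coeff d = ∑ i ∈ Finset.range 3, if 3 * i ≤ d then
      binomialCoeff t (d - 3 * i) (2 * i + r) * j ^ (2 * i + r) * (405 / 2) ^ i else 0 := by
  rw [shiftPoly, finsetSum_coeff]
  refine Finset.sum_congr rfl fun i _ => ?_
  rw [coeff_mul_X_pow', finsetSum_coeff]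
  simp_rw [coeff_C_mul_X_pow, Finset.sum_ite_eq, Finset.mem_range]
  rw [if_pos (show d - 3 * i < 8 by omega)]

/-- The coefficients below degree `8` of the even part `shiftPoly t j 0`. -/
def evenCoeff (t j : ℝ) : ℕ → ℝ
  | 0 => 1
  | 1 => t
  | 3 => 45 / 4 - t ^ 3 / 3 - 45 / 2 * j ^ 2
  | 4 => t ^ 4 / 3 - 15 / 2 * t + 45 * t * j ^ 2
  | 5 => -45 * t ^ 2
  | 6 => -4 / 9 * t ^ 6 + 105 * t ^ 3 - 4455 / 4 + (10125 / 2 - 150 * t ^ 3) * j ^ 2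
      - 3375 / 2 * j ^ 4
  | 7 => 5 / 9 * t ^ 7 - 25 / 4 * t ^ 4 - 62775 / 16 * t + (525 / 2 * t ^ 4 - 23625 / 4 * t) * j ^ 2
      + 23625 / 4 * t * j ^ 4
  | _ => 0

/-- The coefficients below degree `5` of the odd part `shiftPoly t j 1`. -/
def oddCoeff (t j : ℝ) : ℕ → ℝ
  | 0 => j / 3
  | 1 => -t / 3 * j
  | 3 => (5 / 9 * t ^ 3 - 75 / 4) * j + 25 / 2 * j ^ 3
  | 4 => (35 / 2 * t - 7 / 9 * t ^ 4) * j - 35 * t * j ^ 3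
  | _ => 0

theorem coeff_shiftPoly_zero (t j : ℝ) {d : ℕ} (hd : d < 8) :
    (shiftPoly t j 0).coeff d = evenCoeff t j d := by
  rw [coeff_shiftPoly _ _ _ hd]
  simp only [Finset.sum_range_succ, Finset.sum_range_zero, binomialCoeff]
  interval_cases d <;> norm_num [seriesCoeff, evenCoeff, ring_choose_succ] <;> ring

theorem coeff_shiftPoly_one (t j : ℝ) {d : ℕ} (hd : d < 5) :
    (shiftPoly t j 1).coeff d = oddCoeff t j d := by
  rw [coeff_shiftPoly _ _ _ (hd.trans (by norm_num))]
  simp only [Finset.sum_range_succ, Finset.sum_range_zero, binomialCoeff]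
  interval_cases d <;> norm_num [seriesCoeff, oddCoeff, ring_choose_succ] <;> ring

theorem coeff_mul_eq_sum_of_coeff_eq {R : Type*} [Semiring R] {p q : R[X]} {a b : ℕ → R} {N d : ℕ}
    (hp : ∀ d < N, p.coeff d = a d) (hq : ∀ d < N, q.coeff d = b d) (hd : d < N) :
    (p * q).coeff d = ∑ i ∈ Finset.range (d + 1), a i * b (d - i) := by
  rw [coeff_mul, Finset.Nat.sum_antidiagonal_eq_sum_range_succ_mk]
  refine Finset.sum_congr rfl fun i hi => ?_
  rw [Finset.mem_range] at hi
  rw [hp i (by omega), hq (d - i) (by omega)]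

theorem coeff_C_mul_X_pow_mul {R : Type*} [Semiring R] (a : R) (m : ℕ) (p : R[X]) (d : ℕ) :
    (C a * X ^ m * p).coeff d = if m ≤ d then a * p.coeff (d - m) else 0 := by
  rw [mul_assoc, coeff_C_mul, coeff_X_pow_mul', mul_ite, mul_zero]

/-- The cofactor of the central entry in the string form of the formal window with the entries
`shiftPoly t j 0 ± v * shiftPoly t j 1`, where `v ^ 2 = 405 / 2 * X ^ 3`. -/
def cofactorPoly (t : ℝ) : ℝ[X] :=
  2 * (shiftPoly t 1 0 * shiftPoly t 2 0) + 3 * (shiftPoly t 1 0 * shiftPoly t 1 0)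
    + 4 * (shiftPoly t 1 0 * shiftPoly t 0 0) + shiftPoly t 0 0 * shiftPoly t 0 0
    + C (405 / 2) * X ^ 3 *
      (2 * (shiftPoly t 1 1 * shiftPoly t 2 1) + shiftPoly t 1 1 * shiftPoly t 1 1)

/-- The coefficients below degree `8` of `cofactorPoly t`. -/
def cofactorCoeff (t : ℝ) : ℕ → ℝ
  | 0 => 10
  | 1 => 20 * t
  | 2 => 10 * t ^ 2
  | 3 => -20 / 3 * t ^ 3 - 225 / 2
  | 4 => 300 * t
  | 5 => 20 / 3 * t ^ 5 - 75 / 2 * t ^ 2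
  | 6 => -70 / 9 * t ^ 6 - 1350 * t ^ 3 + 99225 / 8
  | 7 => 3000 * t ^ 4 + 11475 * t
  | _ => 0

theorem coeff_cofactorPoly (t : ℝ) {d : ℕ} (hd : d < 8) :
    (cofactorPoly t).coeff d = cofactorCoeff t d := by
  have even (j j' : ℝ) {d : ℕ} : d < 8 → _ := coeff_mul_eq_sum_of_coeff_eq
    (fun _ => coeff_shiftPoly_zero t j) (fun _ => coeff_shiftPoly_zero t j')
  have odd (j j' : ℝ) {d : ℕ} : d < 5 → _ := coeff_mul_eq_sum_of_coeff_eq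
    (fun _ => coeff_shiftPoly_one t j) (fun _ => coeff_shiftPoly_one t j')
  have hd' : d - 3 < 5 := by omega
  simp only [cofactorPoly, coeff_add, coeff_ofNat_mul, coeff_C_mul_X_pow_mul, even _ _ hd,
    odd _ _ hd']
  clear hd' even odd
  interval_cases d <;>
    simp only [Finset.sum_range_succ, Finset.sum_range_zero, evenCoeff, oddCoeff, cofactorCoeff,
      Nat.reduceSub, Nat.reduceAdd, Nat.reduceLeDiff, if_true, if_false] <;>
    ring

theorem X_pow_eight_dvd_stringPoly (t : ℝ) :
    X ^ 8 ∣ shiftPoly t 0 0 * cofactorPoly t - C (30 * t) * X ^ 1 * shiftPoly t 0 0 - C 10 := by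
  rw [X_pow_dvd_iff]
  intro d hd
  rw [coeff_sub, coeff_sub, coeff_C, coeff_C_mul_X_pow_mul, coeff_shiftPoly_zero t 0 (by omega),
    coeff_mul_eq_sum_of_coeff_eq (fun _ => coeff_shiftPoly_zero t 0)
      (fun _ => coeff_cofactorPoly t) hd]
  interval_cases d <;>
    simp only [Finset.sum_range_succ, Finset.sum_range_zero, evenCoeff, cofactorCoeff,
      Nat.reduceSub, Nat.reduceAdd, Nat.reduceLeDiff, if_true, if_false, Nat.reduceEqDiff,
      one_ne_zero] <;>
    ring

theorem one_add_rpow_sub_isBigO (a : ℝ) (n : ℕ) :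
    (fun u : ℝ => (1 + u) ^ a - ∑ i ∈ Finset.range n, Ring.choose a i * u ^ i)
      =O[𝓝 0] fun u => u ^ n := by
  have h := (Real.one_add_rpow_hasFPowerSeriesAt_zero (a := a)).isBigO_sub_partialSum_pow n
  simp only [zero_add, FormalMultilinearSeries.partialSum, binomialSeries_apply,
    List.ofFn_const, List.prod_replicate, smul_eq_mul] at h
  exact h.trans (Asymptotics.isBigO_of_le _ fun u => by simp)

/-- The truncated formal solution at `n * (1 + j / n)`, multiplied by `w = (n / 60) ^ (-1 / 3)`
and written as a function of `w` (so that `w ^ 3 / 60 = 1 / n`). -/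
def profile (t j w : ℝ) : ℝ :=
  ∑ k ∈ Finset.range 8, seriesCoeff t k * (w ^ 2 / 90) ^ k *
    (1 + j * (w ^ 3 / 60)) ^ ((1 - 2 * k) / 3 : ℝ)

/-- The Taylor polynomial of `profile t j` at `w = 0`, split into even and odd part. -/
def profileTaylor (t j w : ℝ) : ℝ :=
  (shiftPoly t j 0).eval (w ^ 2 / 90) + w ^ 3 / 60 * (shiftPoly t j 1).eval (w ^ 2 / 90)

theorem profileTaylor_eq_sum (t j w : ℝ) :
    profileTaylor t j w = ∑ k ∈ Finset.range 8, seriesCoeff t k * (w ^ 2 / 90) ^ k *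
      ∑ i ∈ Finset.range 6, Ring.choose ((1 - 2 * k) / 3 : ℝ) i * (j * (w ^ 3 / 60)) ^ i := by
  simp only [profileTaylor, shiftPoly, eval_finsetSum, eval_mul, eval_pow, eval_X, eval_C,
    Finset.sum_mul]
  rw [Finset.sum_comm, Finset.sum_comm (s := Finset.range 3), Finset.mul_sum,
    ← Finset.sum_add_distrib]
  refine Finset.sum_congr rfl fun k _ => ?_
  simp only [Finset.sum_range_succ, Finset.sum_range_zero, binomialCoeff]
  ring

theorem profile_sub_profileTaylor_isBigO (t j : ℝ) :
    (fun w => profile t j w - profileTaylor t j w) =O[𝓝 0] fun w => w ^ 16 := by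
  simp only [profileTaylor_eq_sum, profile, ← Finset.sum_sub_distrib, ← mul_sub]
  refine Asymptotics.IsBigO.fun_sum fun k _ => ?_
  have hu : Tendsto (fun w : ℝ => j * (w ^ 3 / 60)) (𝓝 0) (𝓝 0) :=
    Continuous.tendsto' (by fun_prop) _ _ (by norm_num)
  have hcoeff : (fun w : ℝ => seriesCoeff t k * (w ^ 2 / 90) ^ k) =O[𝓝 0] fun _ => (1 : ℝ) :=
    (Continuous.tendsto (by fun_prop) 0).isBigO_one ℝ
  have hrem := (one_add_rpow_sub_isBigO ((1 - 2 * k) / 3) 6).comp_tendsto hu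
  have hpow : (fun w : ℝ => (j * (w ^ 3 / 60)) ^ 6) =O[𝓝 0] fun w => w ^ 16 := by
    have hmul : (fun w : ℝ => (j * (w ^ 3 / 60)) ^ 6) = fun w => (j / 60) ^ 6 * w ^ 18 := by
      ext w
      ring
    rw [hmul]
    exact ((Asymptotics.isLittleO_pow_pow (𝕜 := ℝ) (by norm_num)).const_mul_left _).isBigO
  simpa using hcoeff.mul (hrem.trans hpow)

theorem stringForm_symmetric (m e₁ o₁ e₂ o₂ : ℝ) :
    stringForm ![e₂ - o₂, e₁ - o₁, m, e₁ + o₁, e₂ + o₂] =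
      m * (2 * (e₁ * e₂ + o₁ * o₂) + 3 * e₁ ^ 2 + o₁ ^ 2 + 4 * e₁ * m + m ^ 2) := by
  simp only [stringForm, Matrix.cons_val]
  ring

theorem shiftPoly_neg_zero (t j : ℝ) : shiftPoly t (-j) 0 = shiftPoly t j 0 := by
  simp [shiftPoly, pow_mul]

theorem shiftPoly_neg_one (t j : ℝ) : shiftPoly t (-j) 1 = -shiftPoly t j 1 := by
  simp only [shiftPoly, Odd.neg_pow (odd_two_mul_add_one _), mul_neg, neg_mul, C_neg,
    Finset.sum_neg_distrib]

theorem shiftPoly_zero_one (t : ℝ) : shiftPoly t 0 1 = 0 := by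
  simp [shiftPoly]

theorem stringForm_profileTaylor_eq (t w : ℝ) :
    stringForm (fun i => profileTaylor t (i - 2) w) =
      (shiftPoly t 0 0 * cofactorPoly t).eval (w ^ 2 / 90) := by
  have hwindow : (fun i : Fin 5 => profileTaylor t ((i : ℝ) - 2) w) =
      let e (j : ℝ) := (shiftPoly t j 0).eval (w ^ 2 / 90)
      let o (j : ℝ) := w ^ 3 / 60 * (shiftPoly t j 1).eval (w ^ 2 / 90)
      ![e 2 - o 2, e 1 - o 1, e 0, e 1 + o 1, e 2 + o 2] := by
    ext i
    fin_cases i <;> norm_num [profileTaylor, shiftPoly_neg_zero, shiftPoly_neg_one,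
      shiftPoly_zero_one, sub_eq_add_neg]
  rw [hwindow, stringForm_symmetric]
  simp only [cofactorPoly, eval_mul, eval_add, eval_ofNat, eval_pow, eval_X, eval_C]
  ring

theorem stringForm_profileTaylor_isBigO (t : ℝ) :
    (fun w => stringForm (fun i => profileTaylor t (i - 2) w)
      - t / 3 * w ^ 2 * profileTaylor t 0 w - 10) =O[𝓝 0] fun w => w ^ 16 := by
  obtain ⟨q, hq⟩ := X_pow_eight_dvd_stringPoly t
  have hmul (w : ℝ) : stringForm (fun i => profileTaylor t (i - 2) w)
      - t / 3 * w ^ 2 * profileTaylor t 0 w - 10 =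
      (90 ^ 8)⁻¹ * q.eval (w ^ 2 / 90) * w ^ 16 := by
    have h := congrArg (eval (w ^ 2 / 90)) hq
    simp only [eval_sub, eval_mul, eval_pow, eval_X, eval_C] at h
    rw [stringForm_profileTaylor_eq, eval_mul, profileTaylor, shiftPoly_zero_one, eval_zero]
    linear_combination h
  simp_rw [hmul]
  have hq1 : (fun w : ℝ => (90 ^ 8)⁻¹ * q.eval (w ^ 2 / 90)) =O[𝓝 0] fun _ => (1 : ℝ) :=
    (Continuous.tendsto (by fun_prop) 0).isBigO_one ℝ
  simpa using hq1.mul (Asymptotics.isBigO_refl (fun w : ℝ => w ^ 16) (𝓝 0))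

/-- The differential of `stringForm` at the constant window `1`. -/
def stringFormDeriv : (Fin 5 → ℝ) →L[ℝ] ℝ :=
  let d (i : Fin 5) : (Fin 5 → ℝ) →L[ℝ] ℝ := ContinuousLinearMap.proj i
  d 0 + (6 : ℝ) • d 1 + (16 : ℝ) • d 2 + (6 : ℝ) • d 3 + d 4

theorem hasStrictFDerivAt_stringForm_one :
    HasStrictFDerivAt stringForm stringFormDeriv 1 := by
  have d (i : Fin 5) : HasStrictFDerivAt (fun x : Fin 5 → ℝ => x i)
    (ContinuousLinearMap.proj i : (Fin 5 → ℝ) →L[ℝ] ℝ) 1 := hasStrictFDerivAt_apply i 1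
  have h := (d 2).mul ((((((((d 0).mul (d 1)).add ((d 1).pow 2)).add
    (((d 1).const_mul 2).mul (d 2))).add ((d 1).mul (d 3))).add ((d 2).pow 2)).add
    (((d 2).const_mul 2).mul (d 3))).add ((d 3).pow 2) |>.add ((d 3).mul (d 4)))
  refine h.congr_fderiv ?_
  ext x
  simp only [stringFormDeriv, Pi.one_apply, one_smul, Nat.add_one_sub_one, one_pow, nsmul_eq_mul,
    Nat.cast_ofNat, mul_one, smul_add, Pi.add_apply, Pi.mul_apply, add_apply,
    ContinuousLinearMap.proj_apply, smul_apply, smul_eq_mul]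
  ring

theorem tendsto_profile (t j : ℝ) : Tendsto (profile t j) (𝓝 0) (𝓝 1) := by
  have hzero : profile t j 0 = 1 := by
    simp [profile, Finset.sum_range_succ, seriesCoeff]
  rw [← hzero]
  refine tendsto_finsetSum _ fun k _ => ContinuousAt.tendsto (.mul (by fun_prop) ?_)
  exact ContinuousAt.rpow_const (by fun_prop) (Or.inl (by norm_num))

theorem tendsto_profileTaylor (t j : ℝ) : Tendsto (profileTaylor t j) (𝓝 0) (𝓝 1) := by
  have hzero : profileTaylor t j 0 = 1 := by
    simp [profileTaylor, ← coeff_zero_eq_eval_zero, coeff_shiftPoly_zero, evenCoeff]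
  rw [← hzero]
  exact Continuous.tendsto (by unfold profileTaylor; fun_prop) 0

/-- The truncated formal solution at the five points `n * (1 + j / n)`, `-2 ≤ j ≤ 2`, scaled like
`profile`. -/
def profileWindow (t w : ℝ) : Fin 5 → ℝ := fun i => profile t (i - 2) w

theorem tendsto_profileWindow (t : ℝ) : Tendsto (profileWindow t) (𝓝 0) (𝓝 1) :=
  tendsto_pi_nhds.2 fun i => tendsto_profile t (i - 2)

theorem stringForm_profileWindow_isBigO (t : ℝ) :
    (fun w => stringForm (profileWindow t w) - t / 3 * w ^ 2 * profileWindow t w 2 - 10)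
      =O[𝓝 0] fun w => w ^ 16 := by
  have htaylor : Tendsto (fun w => fun i : Fin 5 => profileTaylor t (i - 2) w) (𝓝 0) (𝓝 1) :=
    tendsto_pi_nhds.2 fun i => tendsto_profileTaylor t (i - 2)
  have hform := (hasStrictFDerivAt_stringForm_one.isBigO_sub.comp_tendsto
    ((tendsto_profileWindow t).prodMk_nhds htaylor)).trans
    (Asymptotics.isBigO_pi.2 fun i => profile_sub_profileTaylor_isBigO t (i - 2))
  have hlin := (((Continuous.tendsto (by fun_prop : Continuous fun w : ℝ => t / 3 * w ^ 2)
    0).isBigO_one ℝ).mul (profile_sub_profileTaylor_isBigO t 0))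
  simp only [one_mul] at hlin
  refine ((hform.sub hlin).add (stringForm_profileTaylor_isBigO t)).congr_left fun w => ?_
  have hcentre : profileWindow t w 2 = profile t 0 w := by simp [profileWindow]
  rw [hcentre, Function.comp_apply]
  ring

/-! ### The error of the truncated formal solution -/

/-- `g` is eventually positive and varies by at most the factor `θ` over windows of length
`ℓ + 1`, compared with the entry at place `d`. -/
structure SlowlyVarying (θ : ℝ) (ℓ d : ℕ) (g : ℕ → ℝ) : Prop where
  pos : ∀ᶠ n in atTop, 0 < g n
  le : ∀ᶠ n in atTop, ∀ i ≤ ℓ, g (n + i) ≤ θ * g (n + d)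

-- Iterating `m` times improves the a priori bound to `K * g n + (q * θ) ^ m * B * h n`; the
-- constant `K` also covers the first `d` places, which are not the centre of a window beyond `N`.
theorem le_mul_of_window_contraction {ε g h : ℕ → ℝ} {θ q C K B : ℝ} {ℓ d N : ℕ} (hq : 0 ≤ q)
    (hθ : 0 ≤ θ) (hqθ : q * θ < 1) (hK : 0 ≤ K) (hB : 0 ≤ B) (hCK : C ≤ K * (1 - q * θ))
    (hεh : ∀ n ≥ N, ε n ≤ K * g n + B * h n) (hinit : ∀ n ∈ Set.Ico N (N + d), ε n ≤ K * g n)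
    (hg : ∀ n ≥ N, 0 ≤ g n) (hh : ∀ n ≥ N, 0 ≤ h n)
    (hgle : ∀ n ≥ N, ∀ i ≤ ℓ, g (n + i) ≤ θ * g (n + d))
    (hhle : ∀ n ≥ N, ∀ i ≤ ℓ, h (n + i) ≤ θ * h (n + d))
    (hstep : ∀ n ≥ N, ∀ M, (∀ i ≤ ℓ, ε (n + i) ≤ M) → ε (n + d) ≤ q * M + C * g (n + d)) :
    ∀ n ≥ N, ε n ≤ K * g n := by
  have hiter (m : ℕ) : ∀ n ≥ N, ε n ≤ K * g n + (q * θ) ^ m * B * h n := by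
    induction m with
    | zero => simpa using hεh
    | succ m ih =>
      intro n hn
      have hr : 0 ≤ (q * θ) ^ (m + 1) * B * h n := mul_nonneg (by positivity) (hh n hn)
      rcases lt_or_ge n (N + d) with hnd | hnd
      · linarith [hinit n ⟨hn, hnd⟩]
      obtain ⟨k, rfl⟩ := Nat.exists_eq_add_of_le' (show d ≤ n by omega)
      have hk : N ≤ k := by omega
      have hwindow : ∀ i ≤ ℓ, ε (k + i) ≤ θ * (K * g (k + d) + (q * θ) ^ m * B * h (k + d)) := by
        intro i hi
        calc ε (k + i) ≤ K * g (k + i) + (q * θ) ^ m * B * h (k + i) := ih _ (by omega)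
          _ ≤ K * (θ * g (k + d)) + (q * θ) ^ m * B * (θ * h (k + d)) := by
            gcongr
            exacts [hgle k hk i hi, hhle k hk i hi]
          _ = _ := by ring
      calc ε (k + d) ≤ q * (θ * (K * g (k + d) + (q * θ) ^ m * B * h (k + d))) + C * g (k + d) :=
            hstep k hk _ hwindow
        _ ≤ q * (θ * (K * g (k + d) + (q * θ) ^ m * B * h (k + d)))
            + K * (1 - q * θ) * g (k + d) := by
          gcongr
          exact hg _ hn
        _ = _ := by ring
  intro n hn
  have hpow := tendsto_pow_atTop_nhds_zero_of_lt_one (mul_nonneg hq hθ) hqθ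
  have hlim : Tendsto (fun m : ℕ => K * g n + (q * θ) ^ m * B * h n) atTop (𝓝 (K * g n)) := by
    simpa using ((hpow.mul_const B).mul_const (h n)).const_add (K * g n)
  exact ge_of_tendsto' hlim fun m => hiter m n hn

theorem isBigO_of_window_contraction {ε g h : ℕ → ℝ} {θ q C : ℝ} {ℓ d : ℕ} (hq : 0 ≤ q)
    (hθ : 0 ≤ θ) (hqθ : q * θ < 1) (hε : ∀ n, 0 ≤ ε n) (hεh : ε =O[atTop] h)
    (hg : SlowlyVarying θ ℓ d g) (hh : SlowlyVarying θ ℓ d h)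
    (hstep : ∀ᶠ n in atTop, ∀ M, (∀ i ≤ ℓ, ε (n + i) ≤ M) → ε (n + d) ≤ q * M + C * g (n + d)) :
    ε =O[atTop] g := by
  obtain ⟨B, hB, hεB⟩ := hεh.exists_nonneg
  obtain ⟨N, hN⟩ := eventually_atTop.1 (hεB.bound.and (hg.pos.and (hh.pos.and
    (hg.le.and (hh.le.and hstep)))))
  choose hbound hgpos hhpos hgle hhle hstep using hN
  obtain ⟨K₀, hK₀⟩ := ((Set.finite_Ico N (N + d)).image fun n => ε n / g n).bddAbove
  obtain ⟨K, hK, hK₀K, hCK⟩ := ((eventually_ge_atTop 0).and ((eventually_ge_atTop K₀).and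
    (eventually_ge_atTop (C / (1 - q * θ))))).exists
  rw [div_le_iff₀ (sub_pos.2 hqθ)] at hCK
  have happriori (n : ℕ) (hn : N ≤ n) : ε n ≤ K * g n + B * h n := by
    have hεn := hbound n hn
    rw [Real.norm_of_nonneg (hε n), Real.norm_of_nonneg (hhpos n hn).le] at hεn
    linarith [mul_nonneg hK (hgpos n hn).le]
  have hinit (n : ℕ) (hn : n ∈ Set.Ico N (N + d)) : ε n ≤ K * g n :=
    (div_le_iff₀ (hgpos n hn.1)).1 ((hK₀ (Set.mem_image_of_mem _ hn)).trans hK₀K)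
  refine Asymptotics.IsBigO.of_bound K (eventually_atTop.2 ⟨N, fun n hn => ?_⟩)
  rw [Real.norm_of_nonneg (hε n), Real.norm_of_nonneg (hgpos n hn).le]
  exact le_mul_of_window_contraction hq hθ hqθ hK hB hCK happriori hinit
    (fun n hn => (hgpos n hn).le) (fun n hn => (hhpos n hn).le) hgle hhle hstep n hn

theorem slowlyVarying_scale_zpow {θ : ℝ} (hθ : 1 < θ) (k : ℤ) (ℓ d : ℕ) :
    SlowlyVarying θ ℓ d fun n => scale n ^ k where
  pos := (eventually_gt_atTop 0).mono fun n hn => zpow_pos (scale_pos hn) k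
  le := by
    refine (Set.finite_Iic ℓ).eventually_all.2 fun i _ => ?_
    have h := (tendsto_scale_add_div_scale_add i d).zpow₀ k (Or.inl one_ne_zero)
    rw [one_zpow] at h
    filter_upwards [h.eventually_le_const hθ, eventually_gt_atTop 0] with n hn hpos
    rwa [div_zpow, div_le_iff₀ (zpow_pos (scale_pos (by omega)) k)] at hn

/-- The formal solution of the string equation truncated after the term of order
`x ^ (-13 / 3)`. -/
def approximant (t x : ℝ) : ℝ :=
  ∑ k ∈ Finset.range 8, seriesCoeff t k / 90 ^ k * (x / 60) ^ ((1 - 2 * k) / 3 : ℝ)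

theorem scale_mul_approximant (t j : ℝ) {n : ℕ} (hn : 0 < n) (hj : 0 ≤ n + j) :
    scale n * approximant t (n + j) = profile t j (scale n) := by
  have hshift : ((n : ℝ) + j) / 60 = n / 60 * (1 + j * (scale n ^ 3 / 60)) := by
    rw [scale_pow_three]
    field_simp
  have hnonneg : 0 ≤ 1 + j * (scale n ^ 3 / 60) := by
    have h : 1 + j * (scale n ^ 3 / 60) = (n + j) / n := by
      rw [scale_pow_three]
      field_simp
    rw [h]
    positivity
  have hpow (k : ℕ) : scale n * ((n : ℝ) / 60) ^ ((1 - 2 * k) / 3 : ℝ) = (scale n ^ 2) ^ k := by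
    rw [← pow_mul, scale, ← Real.rpow_mul_natCast (by positivity), ← Real.rpow_add (by positivity)]
    congr 1
    push_cast
    ring
  rw [approximant, profile, Finset.mul_sum]
  refine Finset.sum_congr rfl fun k _ => ?_
  rw [hshift, Real.mul_rpow (by positivity) hnonneg, div_pow (scale n ^ 2), ← hpow k]
  ring

-- The sum `29 / 2` consists of `1 + 6 + 6 + 1` and `1 / 2` for the error of the linearization.
theorem eventually_abs_apply_two_le :
    ∀ᶠ p : (Fin 5 → ℝ) × (Fin 5 → ℝ) in 𝓝 (1, 1),
      16 * |p.1 2 - p.2 2| ≤ 29 / 2 * ‖p.1 - p.2‖ + |stringForm p.1 - stringForm p.2| := by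
  filter_upwards [hasStrictFDerivAt_stringForm_one.isLittleO.bound (half_pos one_pos)]
    with ⟨x, p⟩ hlin
  have hnorm (i : Fin 5) : |x i - p i| ≤ ‖x - p‖ := norm_le_pi_norm (x - p) i
  have h0 := abs_le.1 (hnorm 0)
  have h1 := abs_le.1 (hnorm 1)
  have h3 := abs_le.1 (hnorm 3)
  have h4 := abs_le.1 (hnorm 4)
  simp only [stringFormDeriv, Real.norm_eq_abs, add_apply, smul_apply,
    ContinuousLinearMap.proj_apply, Pi.sub_apply,
    smul_eq_mul] at hlin
  have hF := abs_le.1 (le_refl |stringForm x - stringForm p|)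
  have hlin := abs_le.1 hlin
  rcases abs_cases (x 2 - p 2) with ⟨habs, -⟩ | ⟨habs, -⟩ <;> rw [habs] <;> linarith

section Solution

variable {t : ℝ} {β : ℕ → ℝ}

theorem IsStringSolution.tendsto_scaledWindow (hβ : IsStringSolution t β) :
    Tendsto (scaledWindow β) atTop (𝓝 1) := by
  refine tendsto_pi_nhds.2 fun i => ?_
  have h := (tendsto_scale_add_div_scale_add 2 i).mul
    (hβ.tendsto_scale_mul.comp (tendsto_add_atTop_nat i))
  rw [one_mul] at h
  refine h.congr' ?_
  filter_upwards [eventually_gt_atTop 0] with n hn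
  exact (scaledWindow_apply β (by positivity)).symm

theorem IsStringSolution.sub_approximant_isBigO_inv_scale (hβ : IsStringSolution t β) :
    (fun n : ℕ => β n - approximant t n) =O[atTop] fun n => scale n ^ (-1 : ℤ) := by
  have h := (hβ.tendsto_scale_mul.sub ((tendsto_profile t 0).comp tendsto_scale)).isBigO_one ℝ
  have hmul := h.mul (Asymptotics.isBigO_refl (fun n => scale n ^ (-1 : ℤ)) atTop)
  simp only [one_mul] at hmul
  refine hmul.congr' ?_ EventuallyEq.rfl
  filter_upwards [eventually_gt_atTop 0] with n hn
  have hs := (scale_pos hn).ne'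
  rw [Function.comp_apply, ← scale_mul_approximant t 0 hn (by positivity), add_zero, zpow_neg_one]
  field_simp

theorem scaledWindow_sub_profileWindow (t : ℝ) (β : ℕ → ℝ) (n : ℕ) (i : Fin 5) :
    scaledWindow β n i - profileWindow t (scale (n + 2)) i =
      scale (n + 2) * (β (n + i) - approximant t (n + i : ℕ)) := by
  have hcast : ((n + 2 : ℕ) : ℝ) + (i - 2) = (n + i : ℕ) := by
    push_cast
    ring
  rw [profileWindow, ← scale_mul_approximant t (i - 2) (by omega) (by rw [hcast]; positivity),
    hcast, scaledWindow, Pi.smul_apply, smul_eq_mul, mul_sub]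

theorem abs_apply_two_sub_le {x p : Fin 5 → ℝ} {c r : ℝ} (hc : |c| ≤ 1 / 2)
    (hx : stringForm x = 10 + c * x 2) (hp : |stringForm p - c * p 2 - 10| ≤ r)
    (hlin : 16 * |x 2 - p 2| ≤ 29 / 2 * ‖x - p‖ + |stringForm x - stringForm p|) :
    16 * |x 2 - p 2| ≤ 15 * ‖x - p‖ + r := by
  have hform : |stringForm x - stringForm p| ≤ 1 / 2 * |x 2 - p 2| + r :=
    calc |stringForm x - stringForm p|
        = |c * (x 2 - p 2) - (stringForm p - c * p 2 - 10)| := by rw [hx]; ring_nf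
      _ ≤ |c * (x 2 - p 2)| + |stringForm p - c * p 2 - 10| := abs_sub _ _
      _ ≤ 1 / 2 * |x 2 - p 2| + r := by rw [abs_mul]; gcongr
  have hnorm : |x 2 - p 2| ≤ ‖x - p‖ := norm_le_pi_norm (x - p) 2
  linarith

theorem norm_scaledWindow_sub_profileWindow_le {n : ℕ} {M : ℝ}
    (hM : ∀ i ≤ 4, |β (n + i) - approximant t (n + i : ℕ)| ≤ M) :
    ‖scaledWindow β n - profileWindow t (scale (n + 2))‖ ≤ scale (n + 2) * M := by
  have hw : 0 < scale (n + 2) := scale_pos (by omega)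
  have hM0 : 0 ≤ M := (abs_nonneg _).trans (hM 0 (by norm_num))
  refine (pi_norm_le_iff_of_nonneg (by positivity)).2 fun i => ?_
  rw [Pi.sub_apply, scaledWindow_sub_profileWindow, Real.norm_eq_abs, abs_mul, abs_of_pos hw]
  gcongr
  exact hM i (by omega)

theorem IsStringSolution.exists_contraction (hβ : IsStringSolution t β) :
    ∃ C, ∀ᶠ n in atTop, ∀ M, (∀ i ≤ 4, |β (n + i) - approximant t (n + i : ℕ)| ≤ M) →
      |β (n + 2) - approximant t (n + 2 : ℕ)| ≤ 15 / 16 * M + C * scale (n + 2) ^ 15 := by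
  have hscale : Tendsto (fun n => scale (n + 2)) atTop (𝓝 0) :=
    tendsto_scale.comp (tendsto_add_atTop_nat 2)
  obtain ⟨C, hC⟩ := ((stringForm_profileWindow_isBigO t).comp_tendsto hscale).bound
  have hlin := (hβ.tendsto_scaledWindow.prodMk_nhds
    ((tendsto_profileWindow t).comp hscale)).eventually eventually_abs_apply_two_le
  have hsmall := (tendsto_add_atTop_nat 2).eventually
    ((tendsto_mul_scale_sq (t / 3)).abs.eventually_le_const (abs_zero.trans_lt (half_pos one_pos)))
  refine ⟨C / 16, ?_⟩
  filter_upwards [hC, hlin, hsmall, hβ.stringForm_scaledWindow] with n hC hlin hsmall heq M hM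
  have hw : 0 < scale (n + 2) := scale_pos (by omega)
  rw [Function.comp_apply, Function.comp_apply, Real.norm_eq_abs,
    Real.norm_of_nonneg (by positivity)] at hC
  have hbound := abs_apply_two_sub_le hsmall heq hC hlin
  rw [scaledWindow_sub_profileWindow, abs_mul, abs_of_pos hw, Fin.val_two] at hbound
  refine le_of_mul_le_mul_left ?_ hw
  linear_combination hbound / 16 + 15 / 16 * norm_scaledWindow_sub_profileWindow_le hM

theorem IsStringSolution.sub_approximant_isBigO (hβ : IsStringSolution t β) :
    (fun n : ℕ => β n - approximant t n) =O[atTop] fun n => scale n ^ (15 : ℤ) := by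
  obtain ⟨C, hC⟩ := hβ.exists_contraction
  have hθ : (1 : ℝ) < 31 / 30 := by norm_num
  exact Asymptotics.IsBigO.of_abs_left (isBigO_of_window_contraction (by norm_num)
    (zero_le_one.trans hθ.le) (by norm_num) (fun n => abs_nonneg _)
    hβ.sub_approximant_isBigO_inv_scale.abs_left (slowlyVarying_scale_zpow hθ 15 4 2)
    (slowlyVarying_scale_zpow hθ (-1) 4 2) hC)

end Solution

/-! ### The coefficients in powers of `n` -/

theorem rpow_one_div_three_pow_three {x : ℝ} (hx : 0 ≤ x) : (x ^ (1 / 3 : ℝ)) ^ 3 = x := by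
  rw [← Real.rpow_mul_natCast hx]
  norm_num

theorem rpow_natCast_div_three {x : ℝ} (hx : 0 ≤ x) (m : ℕ) :
    x ^ (m / 3 : ℝ) = (x ^ (1 / 3 : ℝ)) ^ m := by
  rw [← Real.rpow_mul_natCast hx]
  congr 1
  ring

theorem rpow_450_eq : (450 : ℝ) ^ (1 / 3 : ℝ) = ((60 : ℝ) ^ (1 / 3 : ℝ)) ^ 2 / 2 := by
  refine (pow_left_inj₀ (by positivity) (by positivity) three_ne_zero).1 ?_
  rw [rpow_one_div_three_pow_three (by norm_num), div_pow, pow_right_comm,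
    rpow_one_div_three_pow_three (by norm_num)]
  norm_num

theorem div_sixty_rpow {x : ℝ} (hx : 0 < x) (k : ℕ) :
    (x / 60) ^ ((1 - 2 * k) / 3 : ℝ) = x ^ (1 / 3 : ℝ) / 60 ^ (1 / 3 : ℝ) *
      ((60 ^ (1 / 3 : ℝ)) ^ 2 / (x ^ (1 / 3 : ℝ)) ^ 2) ^ k := by
  rw [← div_pow, ← inv_div (x ^ _), ← Real.div_rpow hx.le (by norm_num),
    ← Real.rpow_neg (by positivity), ← pow_mul, ← Real.rpow_mul_natCast (by positivity),
    ← Real.rpow_add (by positivity)]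
  congr 1
  push_cast
  ring

theorem approximant_eq (t : ℝ) {x : ℝ} (hx : 0 < x) :
    approximant t x =
      x ^ (1 / 3 : ℝ) / (60 : ℝ) ^ (1 / 3 : ℝ)
        + t / (3 * (450 : ℝ) ^ (1 / 3 : ℝ) * x ^ (1 / 3 : ℝ))
        - (4 * t ^ 3 - 135) / (2430 * (60 : ℝ) ^ (1 / 3 : ℝ) * x ^ (5 / 3 : ℝ))
        + t * (2 * t ^ 3 - 45) / (3645 * (450 : ℝ) ^ (1 / 3 : ℝ) * x ^ (7 / 3 : ℝ))
        - 2 * t ^ 2 / (1215 * x ^ 3)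
        - (16 * t ^ 6 - 3780 * t ^ 3 + 40095) /
            (1476225 * (60 : ℝ) ^ (1 / 3 : ℝ) * x ^ (11 / 3 : ℝ))
        + t * (16 * t ^ 6 - 180 * t ^ 3 - 112995) /
            (3542940 * (450 : ℝ) ^ (1 / 3 : ℝ) * x ^ (13 / 3 : ℝ)) := by
  have hpow5 := rpow_natCast_div_three hx.le 5
  have hpow7 := rpow_natCast_div_three hx.le 7
  have hpow11 := rpow_natCast_div_three hx.le 11
  have hpow13 := rpow_natCast_div_three hx.le 13
  push_cast at hpow5 hpow7 hpow11 hpow13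
  simp only [approximant, div_sixty_rpow hx, rpow_450_eq, hpow5, hpow7, hpow11, hpow13,
    Finset.sum_range_succ, Finset.sum_range_zero, seriesCoeff]
  have hy := Real.rpow_pos_of_pos hx (1 / 3)
  have hy3 := rpow_one_div_three_pow_three hx.le
  have hc := Real.rpow_pos_of_pos (show (0 : ℝ) < 60 by norm_num) (1 / 3)
  have hc3 : ((60 : ℝ) ^ (1 / 3 : ℝ)) ^ 3 = 60 := rpow_one_div_three_pow_three (by norm_num)
  generalize x ^ (1 / 3 : ℝ) = y at hy hy3 ⊢
  generalize (60 : ℝ) ^ (1 / 3 : ℝ) = c at hc hc3 ⊢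
  subst hy3
  have hcpow (m : ℕ) : c ^ (3 * m) = 60 ^ m := by rw [pow_mul, hc3]
  have hc7 : c ^ 7 = 60 ^ 2 * c := by rw [pow_succ, hcpow 2]
  have hc9 : c ^ 9 = 60 ^ 3 := hcpow 3
  have hc11 : c ^ 11 = 60 ^ 3 * c ^ 2 := by rw [pow_add c 9 2, hc9]
  have hc13 : c ^ 13 = 60 ^ 4 * c := by rw [pow_succ, hcpow 4]
  have hc15 : c ^ 15 = 60 ^ 5 := hcpow 5
  field_simp
  ring_nf
  simp only [hc3, hc7, hc9, hc11, hc13, hc15]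
  ring

end Freud

end

theorem theorem11_general {t : ℝ} {β : ℕ → ℝ} (hβ : Freud.IsStringSolution t β) :
    (fun n : ℕ => β n -
      ((n : ℝ) ^ (1 / 3 : ℝ) / (60 : ℝ) ^ (1 / 3 : ℝ)
        + t / (3 * (450 : ℝ) ^ (1 / 3 : ℝ) * (n : ℝ) ^ (1 / 3 : ℝ))
        - (4 * t ^ 3 - 135) / (2430 * (60 : ℝ) ^ (1 / 3 : ℝ) * (n : ℝ) ^ (5 / 3 : ℝ))
        + t * (2 * t ^ 3 - 45) / (3645 * (450 : ℝ) ^ (1 / 3 : ℝ) * (n : ℝ) ^ (7 / 3 : ℝ))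
        - 2 * t ^ 2 / (1215 * (n : ℝ) ^ 3)
        - (16 * t ^ 6 - 3780 * t ^ 3 + 40095) /
            (1476225 * (60 : ℝ) ^ (1 / 3 : ℝ) * (n : ℝ) ^ (11 / 3 : ℝ))
        + t * (16 * t ^ 6 - 180 * t ^ 3 - 112995) /
            (3542940 * (450 : ℝ) ^ (1 / 3 : ℝ) * (n : ℝ) ^ (13 / 3 : ℝ))))
      =O[Filter.atTop] (fun n : ℕ => ((n : ℝ) ^ 5)⁻¹) := by
  have hscale (n : ℕ) : Freud.scale n ^ (15 : ℤ) = 60 ^ 5 * ((n : ℝ) ^ 5)⁻¹ := by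
    rw [zpow_ofNat, pow_mul (Freud.scale n) 3 5, Freud.scale_pow_three, div_pow, div_eq_mul_inv]
  have h := hβ.sub_approximant_isBigO
  simp_rw [hscale] at h
  refine h.of_const_mul_right.congr' ?_ .rfl
  filter_upwards [Filter.eventually_gt_atTop 0] with n hn
  rw [Freud.approximant_eq t (Nat.cast_pos.2 hn)]

theorem theorem11 (t : ℝ) :
    (fun n : ℕ => Freud.recurrenceCoeff t n -
      ((n : ℝ) ^ (1 / 3 : ℝ) / (60 : ℝ) ^ (1 / 3 : ℝ)
        + t / (3 * (450 : ℝ) ^ (1 / 3 : ℝ) * (n : ℝ) ^ (1 / 3 : ℝ))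
        - (4 * t ^ 3 - 135) / (2430 * (60 : ℝ) ^ (1 / 3 : ℝ) * (n : ℝ) ^ (5 / 3 : ℝ))
        + t * (2 * t ^ 3 - 45) / (3645 * (450 : ℝ) ^ (1 / 3 : ℝ) * (n : ℝ) ^ (7 / 3 : ℝ))
        - 2 * t ^ 2 / (1215 * (n : ℝ) ^ 3)
        - (16 * t ^ 6 - 3780 * t ^ 3 + 40095) /
            (1476225 * (60 : ℝ) ^ (1 / 3 : ℝ) * (n : ℝ) ^ (11 / 3 : ℝ))
        + t * (16 * t ^ 6 - 180 * t ^ 3 - 112995) /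
            (3542940 * (450 : ℝ) ^ (1 / 3 : ℝ) * (n : ℝ) ^ (13 / 3 : ℝ))))
      =O[Filter.atTop] (fun n : ℕ => ((n : ℝ) ^ 5)⁻¹) :=
  theorem11_general
    ((Freud.recurrenceCoeff_isRecurrenceCoeff t).isStringSolution (Freud.monicOP_isMonicOPS t))
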